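/- Let $S$ be a finite semigroup that is aperiodic, i.e. every subgroup of $S$ (every subsemigroup of $S$ that is a group under the multiplication of $S$) is trivial. Let $S^1=S$ if $S$ has an identity element, and otherwise let $S^1=S\cup\{1\}$ be $S$ with an identity element adjoined. Let $(S^1)^*$ be the set of finite words over $S^1$, and let $S^*\subseteq (S^1)^*$ be the set of finite words over $S$. For $s\in S$ define $\varphi_s:(S^1)^*\to S^*\subseteq (S^1)^*$ by $$\varphi_s([a_1,a_2,\ldots,a_k])=[sa_1,\;sa_1a_2,\;\ldots,\;sa_1a_2\cdots a_k],$$ so that the empty word is sent to the empty word, and let $\mathrm{Cayley}(S)$ be the semigroup generated, under composition of functions, by $\{\varphi_s : s\in S\}$. Then there exists an integer $n\ge 1$ such that $f^n=f^{n+1}$ for all $f\in\mathrm{Cayley}(S)$. In particular, $\mathrm{Cayley}(S)$ is aperiodic, i.e. every subgroup of $\mathrm{Cayley}(S)$ is trivial. -/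

import Mathlib

namespace CayleySemigroup

/-- A semigroup is aperiodic if all its subgroups are trivial, a subgroup being a subsemigroup
that is a group under the induced multiplication (its identity `e` may be any idempotent). -/
def IsAperiodic (S : Type*) [Semigroup S] : Prop :=
  ∀ G : Subsemigroup S,
    (∃ e ∈ G, (∀ x ∈ G, e * x = x ∧ x * e = x) ∧ ∀ x ∈ G, ∃ y ∈ G, x * y = e ∧ y * x = e) →
      ∀ x ∈ G, ∀ y ∈ G, x = y

/-- `S` is a monoid, i.e. it has a two-sided identity element. -/
def HasIdentity (S : Type*) [Semigroup S] : Prop :=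
  ∃ e : S, ∀ s : S, e * s = s ∧ s * e = s

/-- The semigroup `S¹`, inside `WithOne S` (which always adjoins a new identity): the new identity
belongs to it only if `S` has no identity of its own. So `S¹` is `S` if `S` is a monoid, and
`S ∪ {1}` otherwise. -/
def SOne (S : Type*) [Semigroup S] : Subsemigroup (WithOne S) where
  carrier := {x | x = 1 → ¬ HasIdentity S}
  mul_mem' := by
    intro x y hx hy h
    induction x using WithOne.recOneCoe with
    | one => exact hx rfl
    | coe a =>
      induction y using WithOne.recOneCoe with
      | one => exact hy rfl
      | coe b => exact absurd h (by rw [← WithOne.coe_mul]; exact WithOne.coe_ne_one)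

/-- The inclusion of `S` in `S¹`. -/
def incl {S : Type*} [Semigroup S] (s : S) : SOne S :=
  ⟨(s : WithOne S), fun h => absurd h WithOne.coe_ne_one⟩

/-- The product `s a`, an element of `S`, of `s ∈ S` and `a ∈ S¹`. -/
def mulRight {S : Type*} [Semigroup S] (s : S) (a : SOne S) : S :=
  WithOne.recOneCoe (motive := fun _ => S) s (fun t => s * t) a.1

theorem incl_mulRight {S : Type*} [Semigroup S] (s : S) (a : SOne S) :
    incl (mulRight s a) = incl s * a := by
  obtain ⟨a, ha⟩ := a
  apply Subtype.ext
  induction a using WithOne.recOneCoe with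
  | one => exact (mul_one (s : WithOne S)).symm
  | coe t => exact WithOne.coe_mul s t

/-- The function `φ_s : (S¹)* → S*`,
`φ_s [a₁, a₂, …, aₙ] = [s a₁, s a₁ a₂, …, s a₁ a₂ ⋯ aₙ]`. -/
def phi {S : Type*} [Semigroup S] : S → List (SOne S) → List S
  | _, [] => []
  | s, a :: w => mulRight s a :: phi (mulRight s a) w

/-- `φ_s` as a self-map of `(S¹)*`, by means of the inclusion of `S*` in `(S¹)*`. -/
def phiEnd {S : Type*} [Semigroup S] (s : S) : Function.End (List (SOne S)) :=
  fun w => (phi s w).map incl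

/-- `Cayley(S)`: the semigroup generated under composition by the functions `φ_s`, `s ∈ S`. -/
def Cayley (S : Type*) [Semigroup S] : Subsemigroup (Function.End (List (SOne S))) :=
  Subsemigroup.closure (Set.range phiEnd)

end CayleySemigroup

/-!
Write `M` for the monoid `WithOne S`; it is finite and, because `S` is aperiodic, there is a `K`
with `x ^ (K + 1) = x ^ K` for all `x : M` (`IsAperiodic.exists_pow_withOne`). The functions `φ_s`
are restrictions of the functions `prefixProd m`, `m : M`, on words over `M`, so it suffices to
bound the stabilisation of compositions of the latter.

Let `f` be a composition of `p` such functions and apply them to a word over and over, listing the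
successive words as the rows of a grid. The states of the automata when they have read `j` letters
form the column `j` of the grid, a sequence `c : ℕ → M`; reading one more letter `a` turns it into
the sequence `d = nextColumn a c`, with `d 0 = c 0 * a` and `d (i + 1) = c (i + 1) * d i`. The
column `0` is `p`-periodic, and the claim is that all columns are `p`-periodic from a row on that
does not depend on the column and is bounded by a multiple of `p` depending on `M` only.

If `c` is periodic from row `N` on, then `d` is periodic from row `N + K * p` on, since one period
multiplies `d` by a fixed element on the left (`PeriodicFrom.nextColumn`). This delay is harmless if
the two-sided ideal generated by the entries of the column becomes smaller, as that happens at
most `|M|` times. If the ideal stays the same, there is no delay at all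
(`PeriodicFrom.nextColumn_of_mem_twoSided`): aperiodicity gives `u * x = x = x * v` whenever
`u * x * v = x` (`eq_of_mul_mul_eq`), whence `d i` and `d (i + p)` both generate the same right
ideal as `c i = c (i + p)`, and as `d (i + p)` is a left multiple of `d i`, they are equal.
-/

namespace CayleySemigroup

/-! ### Aperiodic monoids -/

section Monoid

variable {M : Type*} [Monoid M] {K p N : ℕ} {c : ℕ → M}

/-- In an aperiodic monoid the `𝓗`-classes are trivial and `𝓙`-equivalence of comparable elements
refines to `𝓡`- or `𝓛`-equivalence; both facts follow from this statement. -/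
theorem eq_of_mul_mul_eq (hK : ∀ x : M, x ^ (K + 1) = x ^ K) {u x v : M} (h : u * x * v = x) :
    u * x = x ∧ x * v = x := by
  have key : ∀ n : ℕ, u ^ n * x * v ^ n = x := by
    intro n
    induction n with
    | zero => simp
    | succ n ih =>
      calc u ^ (n + 1) * x * v ^ (n + 1) = u ^ n * (u * x * v) * v ^ n := by
            rw [pow_succ, pow_succ']; simp only [mul_assoc]
        _ = x := by rw [h, ih]
  constructor
  · calc u * x = u ^ (K + 1) * x * v ^ K := by
          conv_lhs => rw [← key K]
          rw [pow_succ']; simp only [mul_assoc]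
      _ = x := by rw [hK, key]
  · calc x * v = u ^ K * x * v ^ (K + 1) := by
          conv_lhs => rw [← key K]
          rw [pow_succ]; simp only [mul_assoc]
      _ = x := by rw [hK, key]

/-- The two-sided ideal of the monoid `M` generated by `x`. -/
def twoSided (x : M) : Set M := {y | ∃ u v, y = u * x * v}

theorem mem_twoSided_self (x : M) : x ∈ twoSided x := ⟨1, 1, by simp⟩

theorem twoSided_subset {x y : M} (h : x ∈ twoSided y) : twoSided x ⊆ twoSided y := by
  obtain ⟨u, v, rfl⟩ := h
  rintro _ ⟨u', v', rfl⟩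
  exact ⟨u' * u, v * v', by simp only [mul_assoc]⟩

theorem ncard_twoSided_lt [Finite M] {x y : M} (h : x ∈ twoSided y) (h' : y ∉ twoSided x) :
    (twoSided x).ncard < (twoSided y).ncard :=
  Set.ncard_lt_ncard ⟨twoSided_subset h, fun H => h' (H (mem_twoSided_self y))⟩ (Set.toFinite _)

/-! ### Columns of the grid -/

/-- The column that follows the column `c` after the letter `a` has been read. -/
def nextColumn (a : M) (c : ℕ → M) : ℕ → M
  | 0 => c 0 * a
  | i + 1 => c (i + 1) * nextColumn a c i

theorem exists_nextColumn_eq_mul_right (a : M) (c : ℕ → M) (i : ℕ) :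
    ∃ h, nextColumn a c i = c i * h := by
  cases i with
  | zero => exact ⟨a, rfl⟩
  | succ i => exact ⟨_, rfl⟩

/-- The product `c (i + n) * ⋯ * c (i + 1)`. -/
def segmentProd (c : ℕ → M) (i : ℕ) : ℕ → M
  | 0 => 1
  | n + 1 => c (i + n + 1) * segmentProd c i n

theorem nextColumn_add (a : M) (c : ℕ → M) (i n : ℕ) :
    nextColumn a c (i + n) = segmentProd c i n * nextColumn a c i := by
  induction n with
  | zero => simp [segmentProd]
  | succ n ih =>
    rw [← add_assoc, nextColumn, ih, segmentProd, mul_assoc]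

/-- The entries of the sequence `c` from index `N` on decrease in the `𝓛`-order. -/
def LeftAntitoneFrom (N : ℕ) (c : ℕ → M) : Prop :=
  ∀ i j, N ≤ i → i ≤ j → ∃ g, c j = g * c i

theorem leftAntitoneFrom_nextColumn (a : M) (c : ℕ → M) (N : ℕ) :
    LeftAntitoneFrom N (nextColumn a c) := by
  intro i j _ hij
  obtain ⟨n, rfl⟩ := Nat.exists_eq_add_of_le hij
  exact ⟨_, nextColumn_add a c i n⟩

/-- The sequence `c` has period `p` from index `N` on. -/
def PeriodicFrom {α : Type*} (p N : ℕ) (c : ℕ → α) : Prop :=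
  ∀ i, N ≤ i → c (i + p) = c i

theorem PeriodicFrom.apply_add_mul {α : Type*} {p N : ℕ} {c : ℕ → α}
    (h : PeriodicFrom p N c) (m : ℕ) {i : ℕ} (hi : N ≤ i) :
    c (i + m * p) = c i := by
  induction m with
  | zero => simp
  | succ m ih => rw [add_mul, one_mul, ← add_assoc, h _ (by omega), ih]

theorem PeriodicFrom.segmentProd_add_mul (h : PeriodicFrom p N c) (m : ℕ) {i : ℕ} (hi : N ≤ i)
    (n : ℕ) : segmentProd c (i + m * p) n = segmentProd c i n := by
  induction n with
  | zero => rfl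
  | succ n ih =>
    rw [segmentProd, segmentProd, ih, show i + m * p + n + 1 = i + n + 1 + m * p by omega,
      h.apply_add_mul m (by omega)]

theorem PeriodicFrom.nextColumn_add_mul (h : PeriodicFrom p N c) (a : M) {i : ℕ} (hi : N ≤ i)
    (m : ℕ) : nextColumn a c (i + m * p) = segmentProd c i p ^ m * nextColumn a c i := by
  induction m with
  | zero => simp
  | succ m ih =>
    rw [add_mul, one_mul, ← add_assoc, CayleySemigroup.nextColumn_add, ih,
      h.segmentProd_add_mul m hi, pow_succ', mul_assoc]

theorem PeriodicFrom.nextColumn (hK : ∀ x : M, x ^ (K + 1) = x ^ K) (h : PeriodicFrom p N c)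
    (a : M) : PeriodicFrom p (N + K * p) (nextColumn a c) := by
  intro j hj
  obtain ⟨i, rfl⟩ : ∃ i, j = i + K * p := ⟨j - K * p, by omega⟩
  rw [show i + K * p + p = i + (K + 1) * p by rw [add_mul, one_mul, add_assoc],
    h.nextColumn_add_mul a (by omega), h.nextColumn_add_mul a (by omega), hK]

/-- If the two-sided ideal generated by the entries of a column does not change in the passage to
the next column, then neither does the row from which the column is periodic. -/
theorem PeriodicFrom.nextColumn_of_mem_twoSided (hK : ∀ x : M, x ^ (K + 1) = x ^ K) (hp : 0 < p)
    (h : PeriodicFrom p N c) (hc : LeftAntitoneFrom N c) (a : M)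
    (hmem : c N ∈ twoSided (CayleySemigroup.nextColumn a c (N + K * p))) :
    PeriodicFrom p N (CayleySemigroup.nextColumn a c) := by
  set d := CayleySemigroup.nextColumn a c with hd
  -- From row `N` on, `c i` and `d i` generate the same right ideal.
  have hR : ∀ i, N ≤ i → ∃ t, c i = d i * t := by
    intro i hi
    obtain ⟨g₁, hg₁⟩ := hc N i le_rfl hi
    obtain ⟨u, v, huv⟩ := hmem
    have hle : i ≤ N + K * p + i * p := by
      have := Nat.le_mul_of_pos_right i hp
      omega
    obtain ⟨g₂, hg₂⟩ := leftAntitoneFrom_nextColumn a c 0 i _ (Nat.zero_le _) hle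
    rw [(h.nextColumn hK a).apply_add_mul i le_rfl] at hg₂
    obtain ⟨r, hr⟩ := exists_nextColumn_eq_mul_right a c i
    have hfix : (g₁ * u * g₂) * c i * (r * v) = c i := by
      calc (g₁ * u * g₂) * c i * (r * v) = g₁ * (u * (g₂ * (c i * r)) * v) := by
            simp only [mul_assoc]
        _ = c i := by rw [← hr, ← hg₂, ← huv, ← hg₁]
    refine ⟨v, ?_⟩
    rw [hd, hr, mul_assoc]
    exact (eq_of_mul_mul_eq hK hfix).2.symm
  intro i hi
  obtain ⟨t, ht⟩ := hR (i + p) (by omega)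
  obtain ⟨r, hr⟩ := exists_nextColumn_eq_mul_right a c i
  obtain ⟨g, hg⟩ := leftAntitoneFrom_nextColumn a c 0 i (i + p) (Nat.zero_le _) (by omega)
  have hfix : g * d i * (t * r) = d i := by
    calc g * d i * (t * r) = d (i + p) * t * r := by rw [← hg]; simp only [mul_assoc, hd]
      _ = d i := by rw [← ht, h i hi, ← hr]
  exact hg.trans (eq_of_mul_mul_eq hK hfix).1

/-! ### Rows of the grid -/

/-- The function `φ_m` for an element `m` of a monoid `M`, as a self-map of the words over `M`. -/
def prefixProd : M → List M → List M
  | _, [] => []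
  | m, a :: w => (m * a) :: prefixProd (m * a) w

/-- The row `i` of the grid with the column of states `c` and the row `0` equal to `w`. The state
`c i` belongs to the automaton that turns row `i` into row `i + 1`, so after a letter has been read
the state `i` is the entry of row `i + 1` at that place. -/
def row (c : ℕ → M) : ℕ → List M → List M
  | 0, w => w
  | i + 1, w => prefixProd (c i) (row c i w)

theorem row_nil (c : ℕ → M) (i : ℕ) : row c i [] = [] := by
  induction i with
  | zero => rfl
  | succ i ih => rw [row, ih, prefixProd]

theorem row_succ_cons (c : ℕ → M) (i : ℕ) (a : M) (w : List M) :
    row c (i + 1) (a :: w) = nextColumn a c i :: row (nextColumn a c) (i + 1) w := by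
  induction i with
  | zero => rfl
  | succ i ih => rw [row, ih]; rfl

theorem row_add (c : ℕ → M) (i j : ℕ) (w : List M) :
    row c (i + j) w = row (fun k => c (i + k)) j (row c i w) := by
  induction j with
  | zero => rfl
  | succ j ih => rw [← add_assoc, row, ih, row]

theorem row_congr {c c' : ℕ → M} {i : ℕ} (h : ∀ k < i, c k = c' k) (w : List M) :
    row c i w = row c' i w := by
  induction i with
  | zero => rfl
  | succ i ih => rw [row, row, ih fun k hk => h k (by omega), h i (by omega)]

theorem row_mul_of_periodic (h : PeriodicFrom p 0 c) (n : ℕ) (w : List M) :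
    row c (n * p) w = (row c p)^[n] w := by
  induction n with
  | zero => simp [row]
  | succ n ih =>
    rw [add_mul, one_mul, row_add, ih, Function.iterate_succ_apply']
    refine row_congr (fun k _ => ?_) _
    rw [add_comm]
    exact h.apply_add_mul n (Nat.zero_le k)

/-- The number of rows that precede the stabilisation of a grid is controlled by the size of the
ideal generated by the entries of its column of states. -/
theorem row_add_period_of_leftAntitoneFrom [Finite M] (hK : ∀ x : M, x ^ (K + 1) = x ^ K)
    (hp : 0 < p) (w : List M) :
    ∀ (c : ℕ → M) (N k : ℕ), PeriodicFrom p N c → LeftAntitoneFrom N c →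
      (twoSided (c N)).ncard ≤ k → ∀ i, N + k * (K * p) ≤ i →
        row c (i + p + 1) w = row c (i + 1) w := by
  induction w with
  | nil => intros; rw [row_nil, row_nil]
  | cons a w ih =>
    intro c N k hper hanti hk i hi
    -- Either the ideal is unchanged and there is no delay, or the delay `K * p` is paid for by the
    -- smaller ideal.
    obtain ⟨N', k', hper', hk', hle⟩ : ∃ N' k', PeriodicFrom p N' (nextColumn a c) ∧
        (twoSided (nextColumn a c N')).ncard ≤ k' ∧
        N' + k' * (K * p) ≤ N + k * (K * p) := by
      have hsub : ∀ i, nextColumn a c i ∈ twoSided (c i) := fun i =>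
        let ⟨r, hr⟩ := exists_nextColumn_eq_mul_right a c i
        ⟨1, r, by rw [hr, one_mul]⟩
      by_cases hmem : c N ∈ twoSided (nextColumn a c (N + K * p))
      · exact ⟨N, k, hper.nextColumn_of_mem_twoSided hK hp hanti a hmem,
          (Set.ncard_le_ncard (twoSided_subset (hsub N)) (Set.toFinite _)).trans hk, le_rfl⟩
      · have hlt := ncard_twoSided_lt (hper.apply_add_mul K le_rfl ▸ hsub (N + K * p)) hmem
        obtain ⟨l, rfl⟩ : ∃ l, k = l + 1 := ⟨k - 1, by omega⟩
        exact ⟨N + K * p, l, hper.nextColumn hK a, by omega, by rw [add_mul, one_mul]; omega⟩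
    have hi' := hle.trans hi
    rw [row_succ_cons, row_succ_cons,
      ih _ N' k' hper' (leftAntitoneFrom_nextColumn a c N') hk' i hi',
      hper' i ((Nat.le_add_right _ _).trans hi')]

/-- The column of states need not be `𝓛`-antitone here: the column that follows it is. -/
theorem row_add_period [Finite M] (hK : ∀ x : M, x ^ (K + 1) = x ^ K) (hp : 0 < p)
    (hc : PeriodicFrom p 0 c) (w : List M) {i : ℕ} (hi : (Nat.card M + 1) * (K * p) ≤ i) :
    row c (i + p + 1) w = row c (i + 1) w := by
  cases w with
  | nil => rw [row_nil, row_nil]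
  | cons a w =>
    have hper := hc.nextColumn hK a
    rw [add_mul, one_mul] at hi
    rw [row_succ_cons, row_succ_cons, hper i (by omega),
      row_add_period_of_leftAntitoneFrom hK hp w _ _ (Nat.card M) hper
        (leftAntitoneFrom_nextColumn a c _) (Set.ncard_le_card _) i (by omega)]

theorem iterate_row_stabilizes [Finite M] (hK : ∀ x : M, x ^ (K + 1) = x ^ K) (hp : 0 < p)
    (c : ℕ → M) (w : List M) :
    (row c p)^[(Nat.card M + 1) * K + 1] w = (row c p)^[(Nat.card M + 1) * K + 1 + 1] w := by
  -- Only the first `p` states matter, so the column may be continued periodically.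
  have hrow : row c p = row (fun i => c (i % p)) p :=
    funext (row_congr fun k hk => by rw [Nat.mod_eq_of_lt hk])
  have hper : PeriodicFrom p 0 (fun i => c (i % p)) := fun i _ => by simp
  obtain ⟨q, rfl⟩ : ∃ q, p = q + 1 := ⟨p - 1, by omega⟩
  rw [hrow, ← row_mul_of_periodic hper, ← row_mul_of_periodic hper]
  have h := row_add_period hK hp hper w
    (show (Nat.card M + 1) * (K * (q + 1)) ≤ (Nat.card M + 1) * K * (q + 1) + q by
      rw [mul_assoc]; omega)
  rw [add_mul (_ + 1) 1, add_mul _ 1, one_mul, ← add_assoc _ q 1, h.symm]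
  congr 1
  omega

end Monoid

/-! ### Powers in an aperiodic semigroup -/

section Semigroup

variable {S : Type*} [Semigroup S]

theorem IsAperiodic.exists_pow_coe [Finite S] (hS : IsAperiodic S) (s : S) :
    ∃ m, ∀ k, m ≤ k → (s : WithOne S) ^ (k + 1) = (s : WithOne S) ^ k := by
  have : Finite (WithOne S) := inferInstanceAs (Finite (Option S))
  set x : WithOne S := (s : WithOne S) with hx
  -- The index `m` is positive, since `x ^ 0` does not lie in `S`.
  obtain ⟨m, p, hm, hp, hmp⟩ : ∃ m p, 1 ≤ m ∧ 1 ≤ p ∧ x ^ (m + p) = x ^ m := by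
    obtain ⟨i, j, hij, h⟩ := Finite.exists_ne_map_eq_of_infinite fun n : ℕ => x ^ (n + 1)
    rcases lt_or_gt_of_ne hij with hlt | hlt
    · exact ⟨i + 1, j - i, by omega, by omega, by
        rw [show i + 1 + (j - i) = j + 1 by omega]; exact h.symm⟩
    · exact ⟨j + 1, i - j, by omega, by omega, by
        rw [show j + 1 + (i - j) = i + 1 by omega]; exact h⟩
  have hper : ∀ k, m ≤ k → ∀ q, x ^ (k + q * p) = x ^ k := fun k hk q =>
    PeriodicFrom.apply_add_mul (c := fun n => x ^ n) (N := m) (fun i hi => by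
      obtain ⟨r, rfl⟩ := Nat.exists_eq_add_of_le hi
      simp only
      rw [show m + r + p = m + p + r by omega, pow_add, hmp, pow_add]) q hk
  have hcoe : ∀ k, 1 ≤ k → ∃ t : S, (t : WithOne S) = x ^ k := by
    intro k hk
    induction k, hk using Nat.le_induction with
    | base => exact ⟨s, by rw [pow_one]⟩
    | succ k _ ih =>
      obtain ⟨t, ht⟩ := ih
      exact ⟨t * s, by rw [WithOne.coe_mul, ht, pow_succ]⟩
  -- The powers with exponent at least `m` form a cyclic group.
  let G : Subsemigroup S :=
    { carrier := {t | ∃ k, m ≤ k ∧ (t : WithOne S) = x ^ k}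
      mul_mem' := by
        rintro t t' ⟨k, hk, ht⟩ ⟨k', hk', ht'⟩
        exact ⟨k + k', by omega, by rw [WithOne.coe_mul, ht, ht', pow_add]⟩ }
  have hmp' : m ≤ m * p := Nat.le_mul_of_pos_right m hp
  have htriv : ∀ t ∈ G, ∀ t' ∈ G, t = t' := by
    obtain ⟨e, he⟩ := hcoe (m * p) (by omega)
    refine hS G ⟨e, ⟨m * p, hmp', he⟩, ?_, ?_⟩
    · rintro t ⟨k, hk, ht⟩
      constructor <;> apply WithOne.coe_injective <;> rw [WithOne.coe_mul, he, ht, ← pow_add]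
      · rw [add_comm, hper k hk]
      · rw [hper k hk]
    · rintro t ⟨k, hk, ht⟩
      obtain ⟨t', ht'⟩ := hcoe (k * (p - 1) + m * p) (by omega)
      have hexp : k + (k * (p - 1) + m * p) = m * p + k * p := by
        obtain ⟨q, rfl⟩ : ∃ q, p = q + 1 := ⟨p - 1, by omega⟩
        simp only [Nat.add_sub_cancel]
        ring
      refine ⟨t', ⟨_, by omega, ht'⟩, ?_, ?_⟩ <;> apply WithOne.coe_injective <;>
        rw [WithOne.coe_mul, he, ht, ht', ← pow_add]
      · rw [hexp, hper _ hmp']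
      · rw [add_comm, hexp, hper _ hmp']
  refine ⟨m, fun k hk => ?_⟩
  obtain ⟨t, ht⟩ := hcoe k (by omega)
  obtain ⟨t', ht'⟩ := hcoe (k + 1) (by omega)
  rw [← ht, ← ht', htriv t ⟨k, hk, ht⟩ t' ⟨k + 1, by omega, ht'⟩]

theorem IsAperiodic.exists_pow_withOne [Finite S] (hS : IsAperiodic S) :
    ∃ K, ∀ x : WithOne S, x ^ (K + 1) = x ^ K := by
  choose m hm using hS.exists_pow_coe
  obtain ⟨K, hK⟩ := (Set.finite_range m).bddAbove
  refine ⟨K, fun x => ?_⟩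
  induction x using WithOne.recOneCoe with
  | one => simp
  | coe s => exact hm s K (hK ⟨s, rfl⟩)

theorem isAperiodic_of_pow_eq {M : Type*} [Monoid M] (T : Subsemigroup M) {n : ℕ} (hn : 1 ≤ n)
    (h : ∀ f ∈ T, f ^ n = f ^ (n + 1)) : IsAperiodic T := by
  rintro G ⟨e, -, he, hinv⟩
  suffices hone : ∀ x ∈ G, x = e from fun x hx y hy => (hone x hx).trans (hone y hy).symm
  intro x hx
  obtain ⟨y, hy, hxy, -⟩ := hinv x hx
  have hxy' : (x : M) * y = e := congrArg Subtype.val hxy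
  have hxe : (x : M) * e = x := congrArg Subtype.val (he x hx).2
  have hpow : (x : M) ^ n * (y : M) ^ n = e := by
    clear h
    induction n, hn using Nat.le_induction with
    | base => simpa using hxy'
    | succ n hn ih =>
      have hxn : (x : M) ^ n * e = x ^ n := by
        obtain ⟨k, rfl⟩ : ∃ k, n = k + 1 := ⟨n - 1, by omega⟩
        rw [pow_succ, mul_assoc, hxe]
      calc (x : M) ^ (n + 1) * (y : M) ^ (n + 1) = x ^ n * (x * y) * y ^ n := by
            rw [pow_succ, pow_succ']; simp only [mul_assoc]
        _ = e := by rw [hxy', hxn, ih]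
  apply Subtype.ext
  calc (x : M) = x * (x ^ n * y ^ n) := by rw [hpow, hxe]
    _ = e := by rw [← mul_assoc, ← pow_succ', ← h x x.2, hpow]

/-! ### From words over `S¹` to words over a monoid -/

theorem coe_incl_mulRight (s : S) (a : SOne S) :
    ((mulRight s a : S) : WithOne S) = (s : WithOne S) * a.1 :=
  congrArg Subtype.val (incl_mulRight s a)

theorem map_val_phiEnd (s : S) (w : List (SOne S)) :
    (phiEnd s w).map Subtype.val = prefixProd (s : WithOne S) (w.map Subtype.val) := by
  unfold phiEnd
  induction w generalizing s with
  | nil => rfl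
  | cons a w ih =>
    simp only [phi, List.map_cons, prefixProd, ih, ← coe_incl_mulRight]
    rfl

/-- Every element of `Cayley(S)` is the restriction to words over `S¹` of the passage from row `0`
to row `p` in a grid over `WithOne S`. -/
theorem exists_row_of_mem_cayley {f : Function.End (List (SOne S))} (hf : f ∈ Cayley S) :
    ∃ (p : ℕ) (c : ℕ → WithOne S), 0 < p ∧
      ∀ w, (f w).map Subtype.val = row c p (w.map Subtype.val) := by
  induction hf using Subsemigroup.closure_induction with
  | mem f hf =>
    obtain ⟨s, rfl⟩ := hf
    exact ⟨1, fun _ => s, one_pos, map_val_phiEnd s⟩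
  | mul f g _ _ hf hg =>
    obtain ⟨p, c, hp, hf⟩ := hf
    obtain ⟨q, d, -, hg⟩ := hg
    refine ⟨q + p, fun i => if i < q then d i else c (i - q), by omega, fun w => ?_⟩
    change (f (g w)).map Subtype.val = _
    rw [row_add, hf, hg]
    rw [row_congr (c := fun i => if i < q then d i else c (i - q)) (c' := d)
      fun k hk => if_pos hk]
    exact row_congr (fun k _ => by simp) _

theorem exists_pow_eq_pow_succ [Finite S] (hS : IsAperiodic S) :
    ∃ n : ℕ, 1 ≤ n ∧ ∀ f ∈ Cayley S, f ^ n = f ^ (n + 1) := by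
  have : Finite (WithOne S) := inferInstanceAs (Finite (Option S))
  obtain ⟨K, hK⟩ := hS.exists_pow_withOne
  refine ⟨(Nat.card (WithOne S) + 1) * K + 1, by omega, fun f hf => ?_⟩
  obtain ⟨p, c, hp, hrow⟩ := exists_row_of_mem_cayley hf
  have hpow : ∀ (n : ℕ) (w : List (SOne S)),
      ((f ^ n) w).map Subtype.val = (row c p)^[n] (w.map Subtype.val) := by
    intro n w
    induction n with
    | zero => rfl
    | succ n ih =>
      rw [pow_succ']
      change (f ((f ^ n) w)).map Subtype.val = _
      rw [hrow, ih, Function.iterate_succ_apply']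
  funext w
  apply List.map_injective_iff.mpr Subtype.val_injective
  rw [hpow, hpow, iterate_row_stabilizes hK hp]

end Semigroup

end CayleySemigroup

theorem mainTheorem2 (S : Type*) [Semigroup S] [Finite S]
    (hS : CayleySemigroup.IsAperiodic S) :
    (∃ n : ℕ, 1 ≤ n ∧ ∀ f ∈ CayleySemigroup.Cayley S, f ^ n = f ^ (n + 1)) ∧
      CayleySemigroup.IsAperiodic (CayleySemigroup.Cayley S) := by
  obtain ⟨n, hn, h⟩ := CayleySemigroup.exists_pow_eq_pow_succ hS
  exact ⟨⟨n, hn, h⟩, CayleySemigroup.isAperiodic_of_pow_eq _ hn h⟩
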